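/- Let $k\in\{0,1,2,\dots\}$ and let $L^*$ be the space of continuous functions $f:[0,\infty)\to\mathbb R$ with $f(0)=0$ that have a weak derivative $f'$ (equivalently, in this setting, are locally absolutely continuous) and satisfy $\int_0^\infty\big[(f'(x))^2+x^{\frac1{2k+1}}f(x)^2\big]dx<\infty$. For $\beta>0$ and a standard Brownian motion $W$ on $[0,\infty)$, let $$TW_{\beta,k}:=\sup_{f\in L^*,\ \|f\|_{2}=1}\ \left\{\frac{2}{\sqrt\beta}\int_0^\infty f(x)^2x^{-\frac{k}{2k+1}}\,dW_x-\int_0^\infty\Big[(f'(x))^2+x^{\frac1{2k+1}}f(x)^2\Big]dx\right\},$$ where the stochastic integral is defined path by path through integration by parts: with $g(x)=f(x)^2x^{-k/(2k+1)}$, $$\int_0^\infty g\,dW=\lim_{R\to\infty}\Big(g(R)W_R-\int_0^R g'(x)W_x\,dx\Big),$$ a limit which almost surely exists for all $f\in L^*$ simultaneously (the supremum is taken over the $f$ for which it exists). The law of $TW_{\beta,k}$ (the $k$-th higher order Tracy–Widom($\beta$) law) is that of minus the ground state eigenvalue of the operator $-\frac{d^2}{dx^2}+x^{\frac1{2k+1}}+\frac{2}{\sqrt\beta}x^{-\frac{k}{2k+1}}W'(x)$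 on the positive half-line with Dirichlet condition at $0$. Let $0<\beta_1<\beta_2$ and $\frac{1}{4k+3}\le s\le\frac{4k+2}{4k+3}$. Then $\beta_1^s\,TW_{\beta_1,k}\succeq\beta_2^s\,TW_{\beta_2,k}$, i.e. both sides are random variables and, whichever Brownian motions are used to define the two sides, $$\mathbb P\big(\beta_1^s\,TW_{\beta_1,k}>t\big)\ \ge\ \mathbb P\big(\beta_2^s\,TW_{\beta_2,k}>t\big)\qquad\text{for all } t\in\mathbb R.$$ -/

import Mathlib

open MeasureTheory ProbabilityTheory Filter Topology Set
open scoped NNReal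

noncomputable section

/-- The space `L*` of index `k`: functions on `[0, ∞)` vanishing at the origin, with an
`L²`-derivative (i.e. locally absolutely continuous with `f' ∈ L²`), and with
`∫₀^∞ [(f')² + x^{1/(2k+1)} f²] dx < ∞`. Only the values of `f` on `[0, ∞)` matter. -/
structure MemLStar (k : ℕ) (f : ℝ → ℝ) : Prop where
  absolutelyContinuous : ∀ R : ℝ, 0 < R → AbsolutelyContinuousOnInterval f 0 R
  map_zero : f 0 = 0
  integrableOn :
    IntegrableOn (fun x : ℝ => deriv f x ^ 2 + x ^ (1 / (2 * (k : ℝ) + 1)) * f x ^ 2) (Ioi 0)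

/-- The energy `∫₀^∞ [(f')² + x^{1/(2k+1)} f²] dx`. -/
def energy (k : ℕ) (f : ℝ → ℝ) : ℝ :=
  ∫ x in Ioi (0 : ℝ), (deriv f x ^ 2 + x ^ (1 / (2 * (k : ℝ) + 1)) * f x ^ 2)

/-- The Wiener integral `∫₀^R g dw` of a deterministic, absolutely continuous integrand `g` with
`g 0 = 0` along a continuous path `w`, read as a Stieltjes integral through integration by parts. -/
def wienerIntegralUpTo (w : ℝ≥0 → ℝ) (g : ℝ → ℝ) (R : ℝ) : ℝ :=
  g R * w R.toNNReal - ∫ x in (0 : ℝ)..R, deriv g x * w x.toNNReal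

/-- `∫₀^∞ g dw` exists, as the limit of `∫₀^R g dw` as `R → ∞`, and equals `c`. -/
def HasWienerIntegral (w : ℝ≥0 → ℝ) (g : ℝ → ℝ) (c : ℝ) : Prop :=
  Tendsto (wienerIntegralUpTo w g) atTop (𝓝 c)

/-- The supremum over `f ∈ L*` with `‖f‖₂ = 1` of
`(2/√β) ∫₀^∞ f² x^{-k/(2k+1)} dw - ∫₀^∞ [(f')² + x^{1/(2k+1)} f²] dx`,
taken in the extended reals, so that no convention about unbounded sets enters. The number `c` is
the value of the noise integral: for almost every Brownian path it exists for all `f ∈ L*`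
simultaneously. -/
def higherTW (k : ℕ) (β : ℝ) (w : ℝ≥0 → ℝ) : EReal :=
  ⨆ (f : ℝ → ℝ) (_ : MemLStar k f) (_ : ∫ x in Ioi (0 : ℝ), f x ^ 2 = 1)
    (c : ℝ) (_ : HasWienerIntegral w (fun x => f x ^ 2 * x ^ (-(k : ℝ) / (2 * (k : ℝ) + 1))) c),
    ((2 / √β * c - energy k f : ℝ) : EReal)

/-- Stochastic domination `X ⪰ Y` of (extended) real random variables, possibly living on different
probability spaces: `ℙ(X > t) ≥ ℙ(Y > t)` for every real `t`. -/
structure StochDominates {Ω Ω' : Type*} [MeasurableSpace Ω] [MeasurableSpace Ω']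
    (X : Ω → EReal) (P : Measure Ω) (Y : Ω' → EReal) (P' : Measure Ω') : Prop where
  aemeasurable_left : AEMeasurable X P
  aemeasurable_right : AEMeasurable Y P'
  tail_le : ∀ t : ℝ, P' {ω | (t : EReal) < Y ω} ≤ P {ω | (t : EReal) < X ω}

end

/-!
Replacing a trial function `f` by `√m f (m ·)` and the path `w` by `m^{-1/2} w (m ·)` preserves
`‖f‖₂`, multiplies the noise integral by a power of `m`, and multiplies the kinetic and potential
parts of the energy by `m²` and `m^{-1/(2k+1)}`. Choose `m` as the power of `β₂ / β₁` for which the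
noise terms of `β₁^s TW_{β₁,k}` and `β₂^s TW_{β₂,k}` agree; the two bounds on `s` say exactly that
neither part of the energy is then larger on the left than on the right. This compares the two
suprema path by path, and Brownian scaling turns the comparison into one of laws.

The law of the supremum does not depend on the Brownian motion, and the supremum is measurable,
because along a continuous path it may be taken over the trial functions of bounded support, by
cutting off. Their noise integrals are continuous functionals of the path in `C(ℝ≥0, ℝ)`, so the
supremum is lower semicontinuous there, and a Borel functional of a continuous path is a measurable
function of its values at a countable dense set of times.
-/

section PathLaw

instance polishSpace_continuousMap {T E : Type*} [TopologicalSpace T] [TopologicalSpace E]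
    [LocallyCompactSpace T] [SecondCountableTopology T] [PolishSpace E] : PolishSpace C(T, E) := by
  let := TopologicalSpace.upgradeIsCompletelyMetrizable E
  infer_instance

variable {T E F Ω Ω' : Type*} [MeasurableSpace E] [MeasurableSpace F]
  [MeasurableSpace Ω] [MeasurableSpace Ω'] {P : Measure Ω} {P' : Measure Ω'}
  {X : T → Ω → E} {Y : T → Ω' → E}

lemma identDistrib_comp_of_forall_finset_restrict [IsFiniteMeasure P']
    (h : ∀ I : Finset T,
      IdentDistrib (fun ω => I.restrict (X · ω)) (fun ω => I.restrict (Y · ω)) P P')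
    {ι : Type*} [Countable ι] (u : ι → T) :
    IdentDistrib (fun ω i => X (u i) ω) (fun ω i => Y (u i) ω) P P' := by
  classical
  have eval (i : ι) : IdentDistrib (X (u i)) (Y (u i)) P P' :=
    (h {u i}).comp
      (measurable_pi_apply (⟨u i, Finset.mem_singleton_self _⟩ : ({u i} : Finset T)))
  have hX : AEMeasurable (fun ω i => X (u i) ω) P :=
    aemeasurable_pi_lambda _ fun i => (eval i).aemeasurable_fst
  have hY : AEMeasurable (fun ω i => Y (u i) ω) P' :=
    aemeasurable_pi_lambda _ fun i => (eval i).aemeasurable_snd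
  have restrict_comp (J : Finset ι) :
      P.map (fun ω => J.restrict fun i => X (u i) ω) =
        P'.map (fun ω => J.restrict fun i => Y (u i) ω) := by
    let reindex (x : J.image u → E) (j : J) : E := x ⟨u j, Finset.mem_image_of_mem u j.2⟩
    have measurable_reindex : Measurable reindex :=
      measurable_pi_lambda _ fun j => measurable_pi_apply _
    exact ((h (J.image u)).comp measurable_reindex).map_eq
  have hlim := isProjectiveLimit_map hX
  simp_rw [restrict_comp] at hlim
  exact ⟨hX, hY, hlim.unique (isProjectiveLimit_map hY)⟩

variable [TopologicalSpace T] [LocallyCompactSpace T] [SecondCountableTopology T] [Nonempty T]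
  [TopologicalSpace E] [PolishSpace E] [BorelSpace E]

lemma exists_measurable_eq_comp_denseSeq [Nonempty F] {Φ : (T → E) → F}
    (hΦ : Measurable[borel C(T, E)] fun w : C(T, E) => Φ w) :
    ∃ G : (ℕ → E) → F, Measurable G ∧
      ∀ w : T → E, Continuous w → Φ w = G fun n => w (TopologicalSpace.denseSeq T n) := by
  borelize C(T, E)
  have sample_embedding : MeasurableEmbedding
      fun (w : C(T, E)) (n : ℕ) => w (TopologicalSpace.denseSeq T n) :=
    Continuous.measurableEmbedding (by fun_prop) fun w w' h => DFunLike.coe_injective <|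
      (map_continuous w).ext_on (TopologicalSpace.denseRange_denseSeq T) (map_continuous w')
        (forall_mem_range.2 (congrFun h))
  obtain ⟨G, hG, hGΦ⟩ := sample_embedding.exists_measurable_extend hΦ fun _ => inferInstance
  exact ⟨G, hG, fun w hw => (congrFun hGΦ ⟨w, hw⟩).symm⟩

theorem identDistrib_path_functional [IsFiniteMeasure P']
    (h : ∀ I : Finset T,
      IdentDistrib (fun ω => I.restrict (X · ω)) (fun ω => I.restrict (Y · ω)) P P')
    (hX : ∀ᵐ ω ∂P, Continuous (X · ω)) (hY : ∀ᵐ ω ∂P', Continuous (Y · ω)) [Nonempty F]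
    {Φ : (T → E) → F} (hΦ : Measurable[borel C(T, E)] fun w : C(T, E) => Φ w) :
    IdentDistrib (fun ω => Φ (X · ω)) (fun ω => Φ (Y · ω)) P P' := by
  obtain ⟨G, hG, hGΦ⟩ := exists_measurable_eq_comp_denseSeq hΦ
  have sampled := (identDistrib_comp_of_forall_finset_restrict h
    (TopologicalSpace.denseSeq T)).comp hG
  have hXG : (fun ω => Φ (X · ω)) =ᵐ[P] _ := hX.mono fun ω hω => hGΦ _ hω
  have hYG : (fun ω => Φ (Y · ω)) =ᵐ[P'] _ := hY.mono fun ω hω => hGΦ _ hω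
  exact ((IdentDistrib.of_ae_eq (sampled.aemeasurable_fst.congr hXG.symm) hXG).trans sampled).trans
    (IdentDistrib.of_ae_eq sampled.aemeasurable_snd hYG.symm)

end PathLaw

lemma identDistrib_brownian_functional {Ω Ω' F : Type*} [MeasurableSpace Ω] [MeasurableSpace Ω']
    [MeasurableSpace F] [Nonempty F] {P : Measure Ω} {P' : Measure Ω'} {W : ℝ≥0 → Ω → ℝ}
    {W' : ℝ≥0 → Ω' → ℝ} (hW : IsBrownianReal W P) (hW' : IsBrownianReal W' P')
    {Φ : (ℝ≥0 → ℝ) → F} (hΦ : Measurable[borel C(ℝ≥0, ℝ)] fun w : C(ℝ≥0, ℝ) => Φ w) :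
    IdentDistrib (fun ω => Φ (W · ω)) (fun ω => Φ (W' · ω)) P P' := by
  have := hW'.isGaussianProcess.isProbabilityMeasure
  exact identDistrib_path_functional
    (fun I => (hW.hasLaw I).identDistrib (hW'.hasLaw I)) hW.cont hW'.cont hΦ

/-- The integrand `f² x^{-k/(2k+1)}` of the noise integral in `higherTW`. -/
noncomputable def noiseDensity (k : ℕ) (f : ℝ → ℝ) (x : ℝ) : ℝ :=
  f x ^ 2 * x ^ (-(k : ℝ) / (2 * (k : ℝ) + 1))

namespace MemLStar

variable {k : ℕ} {f : ℝ → ℝ}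

lemma continuousOn (hf : MemLStar k f) : ContinuousOn f (Ici 0) := by
  intro x (hx : 0 ≤ x)
  have hcont : ContinuousOn f (Icc 0 (x + 1)) := by
    simpa [uIcc_of_le (add_nonneg hx zero_le_one)] using
      (hf.absolutelyContinuous (x + 1) (by positivity)).continuousOn
  refine (hcont x ⟨hx, by linarith⟩).mono_of_mem_nhdsWithin ?_
  rw [← Ici_inter_Iic]
  exact inter_mem self_mem_nhdsWithin (nhdsWithin_le_nhds (Iic_mem_nhds (lt_add_one x)))

lemma aestronglyMeasurable (hf : MemLStar k f) :
    AEStronglyMeasurable f (volume.restrict (Ioi 0)) :=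
  (hf.continuousOn.mono Ioi_subset_Ici_self).aestronglyMeasurable measurableSet_Ioi

lemma ae_differentiableAt (hf : MemLStar k f) :
    ∀ᵐ x ∂volume.restrict (Ioi 0), DifferentiableAt ℝ f x := by
  have on_Icc (n : ℕ) : ∀ᵐ x : ℝ, x ∈ uIcc (0 : ℝ) (n + 1) → DifferentiableAt ℝ f x :=
    (hf.absolutelyContinuous (n + 1) (by positivity)).ae_differentiableAt
  filter_upwards [ae_restrict_mem measurableSet_Ioi, ae_restrict_of_ae (ae_all_iff.2 on_Icc)]
    with x (hx0 : 0 < x) hx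
  refine hx ⌈x⌉₊ (mem_uIcc_of_le hx0.le ?_)
  linarith [Nat.le_ceil x]

lemma integrableOn_deriv_sq (hf : MemLStar k f) :
    IntegrableOn (fun x => deriv f x ^ 2) (Ioi 0) := by
  refine hf.integrableOn.mono' ((measurable_deriv f).pow_const 2).aestronglyMeasurable ?_
  filter_upwards [ae_restrict_mem measurableSet_Ioi] with x (hx : 0 < x)
  rw [Real.norm_of_nonneg (by positivity)]
  exact le_add_of_nonneg_right (by positivity)

lemma integrableOn_potential (hf : MemLStar k f) :
    IntegrableOn (fun x => x ^ (1 / (2 * (k : ℝ) + 1)) * f x ^ 2) (Ioi 0) := by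
  simpa [Pi.sub_def] using hf.integrableOn.sub hf.integrableOn_deriv_sq

lemma energy_eq (hf : MemLStar k f) :
    energy k f = (∫ x in Ioi (0 : ℝ), deriv f x ^ 2) +
      ∫ x in Ioi (0 : ℝ), x ^ (1 / (2 * (k : ℝ) + 1)) * f x ^ 2 :=
  integral_add hf.integrableOn_deriv_sq hf.integrableOn_potential

lemma sq_le (hf : MemLStar k f) {x : ℝ} (hx : 0 < x) :
    f x ^ 2 ≤ x * ∫ y in Ioi (0 : ℝ), deriv f y ^ 2 := by
  have hac := hf.absolutelyContinuous x hx
  have integral_deriv : ∫ y in Ioc 0 x, deriv f y = f x := by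
    rw [← intervalIntegral.integral_of_le hx.le, hac.integral_deriv_eq_sub, hf.map_zero, sub_zero]
  have jensen : (⨍ y in Ioc 0 x, deriv f y) ^ 2 ≤ ⨍ y in Ioc 0 x, deriv f y ^ 2 :=
    (even_two.convexOn_pow (𝕜 := ℝ)).map_set_average_le (continuous_pow 2).continuousOn
      isClosed_univ (by simp [hx]) (by simp) (by simp)
      ((intervalIntegrable_iff_integrableOn_Ioc_of_le hx.le).1 hac.intervalIntegrable_deriv)
      (hf.integrableOn_deriv_sq.mono_set Ioc_subset_Ioi_self)
  simp only [setAverage_eq, Real.volume_real_Ioc_of_le hx.le, sub_zero, smul_eq_mul,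
    integral_deriv] at jensen
  calc f x ^ 2 = x ^ 2 * (x⁻¹ * f x) ^ 2 := by field_simp
    _ ≤ x ^ 2 * (x⁻¹ * ∫ y in Ioc 0 x, deriv f y ^ 2) := by gcongr
    _ = x * ∫ y in Ioc 0 x, deriv f y ^ 2 := by field_simp
    _ ≤ x * ∫ y in Ioi (0 : ℝ), deriv f y ^ 2 := by
      gcongr ?_ * ?_
      exact setIntegral_mono_set hf.integrableOn_deriv_sq (ae_of_all _ fun y => sq_nonneg _)
        Ioc_subset_Ioi_self.eventuallyLE

end MemLStar

section NoiseDensity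

variable {k : ℕ} {f : ℝ → ℝ} {M x : ℝ}

lemma hasDerivAt_noiseDensity (hx : 0 < x) (hd : DifferentiableAt ℝ f x) :
    HasDerivAt (noiseDensity k f)
      (2 * f x * deriv f x * x ^ (-(k : ℝ) / (2 * (k : ℝ) + 1)) +
        f x ^ 2 * (-(k : ℝ) / (2 * (k : ℝ) + 1) * x ^ (-(k : ℝ) / (2 * (k : ℝ) + 1) - 1))) x := by
  refine ((hd.hasDerivAt.pow 2).mul (Real.hasDerivAt_rpow_const
    (p := -(k : ℝ) / (2 * (k : ℝ) + 1)) (Or.inl hx.ne'))).congr_deriv ?_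
  simp

lemma neg_one_lt_two_mul_noiseExponent (k : ℕ) :
    -1 < 2 * (-(k : ℝ) / (2 * (k : ℝ) + 1)) := by
  rw [mul_div_assoc', lt_div_iff₀ (by positivity)]
  linarith

namespace MemLStar

lemma continuousOn_noiseDensity (hf : MemLStar k f) : ContinuousOn (noiseDensity k f) (Ioi 0) :=
  ((hf.continuousOn.mono Ioi_subset_Ici_self).pow 2).mul fun _ hx =>
    (Real.continuousAt_rpow_const _ _ (Or.inl (ne_of_gt hx))).continuousWithinAt

lemma intervalIntegrable_sq_mul_rpow (hf : MemLStar k f) (hM : 0 ≤ M) {a : ℝ} (ha : -1 < a) :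
    IntervalIntegrable (fun x => f x ^ 2 * x ^ a) volume 0 M :=
  (intervalIntegral.intervalIntegrable_rpow' ha).continuousOn_mul <|
    (hf.continuousOn.mono (by simp [uIcc_of_le hM, Icc_subset_Ici_self])).pow 2

lemma intervalIntegrable_noiseDensity (hf : MemLStar k f) (hM : 0 ≤ M) :
    IntervalIntegrable (noiseDensity k f) volume 0 M :=
  hf.intervalIntegrable_sq_mul_rpow hM (by linarith [neg_one_lt_two_mul_noiseExponent k])

lemma intervalIntegrable_sq_mul_rpow_sub_one (hf : MemLStar k f) (hM : 0 ≤ M) {a : ℝ}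
    (ha : -1 < a) : IntervalIntegrable (fun x => f x ^ 2 * x ^ (a - 1)) volume 0 M := by
  rw [intervalIntegrable_iff_integrableOn_Ioc_of_le hM]
  have hdom : IntegrableOn (fun x => (∫ y in Ioi (0 : ℝ), deriv f y ^ 2) * x ^ a) (Ioc 0 M) :=
    (intervalIntegrable_iff_integrableOn_Ioc_of_le hM).1
      ((intervalIntegral.intervalIntegrable_rpow' ha).const_mul _)
  refine hdom.mono' ?_ ((ae_restrict_mem measurableSet_Ioc).mono ?_)
  · exact ((hf.aestronglyMeasurable.mono_set Ioc_subset_Ioi_self).pow 2).mul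
      (measurable_id.pow_const _).aestronglyMeasurable
  · intro x ⟨hx, _⟩
    rw [Real.norm_of_nonneg (by positivity)]
    calc f x ^ 2 * x ^ (a - 1)
        ≤ x * (∫ y in Ioi (0 : ℝ), deriv f y ^ 2) * x ^ (a - 1) := by gcongr; exact hf.sq_le hx
      _ = (∫ y in Ioi (0 : ℝ), deriv f y ^ 2) * x ^ a := by
        rw [Real.rpow_sub_one hx.ne']
        field_simp

lemma intervalIntegrable_deriv_noiseDensity (hf : MemLStar k f) (hM : 0 ≤ M) :
    IntervalIntegrable (deriv (noiseDensity k f)) volume 0 M := by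
  set a : ℝ := -(k : ℝ) / (2 * (k : ℝ) + 1)
  have ha : -1 < 2 * a := neg_one_lt_two_mul_noiseExponent k
  have product_integrable :
      IntervalIntegrable (fun x => 2 * f x * deriv f x * x ^ a) volume 0 M := by
    have hdom : IntegrableOn (fun x => deriv f x ^ 2 + f x ^ 2 * x ^ (2 * a)) (Ioc 0 M) :=
      (hf.integrableOn_deriv_sq.mono_set Ioc_subset_Ioi_self).add
        ((intervalIntegrable_iff_integrableOn_Ioc_of_le hM).1
          (hf.intervalIntegrable_sq_mul_rpow hM ha))
    rw [intervalIntegrable_iff_integrableOn_Ioc_of_le hM]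
    refine hdom.mono' ?_ ((ae_restrict_mem measurableSet_Ioc).mono fun x ⟨hx, _⟩ => ?_)
    · exact (((hf.aestronglyMeasurable.mono_set Ioc_subset_Ioi_self).const_mul 2).mul
        (measurable_deriv f).aestronglyMeasurable).mul
        (measurable_id.pow_const _).aestronglyMeasurable
    · rw [two_mul a, Real.rpow_add hx, Real.norm_eq_abs, abs_le]
      constructor <;>
        nlinarith [sq_nonneg (deriv f x + f x * x ^ a), sq_nonneg (deriv f x - f x * x ^ a)]
  refine (product_integrable.add ((hf.intervalIntegrable_sq_mul_rpow_sub_one hM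
    (by linarith)).const_mul a)).congr_ae ?_
  rw [uIoc_of_le hM]
  filter_upwards [ae_restrict_mem measurableSet_Ioc,
    ae_restrict_of_ae_restrict_of_subset Ioc_subset_Ioi_self hf.ae_differentiableAt] with x hx hd
  rw [(hasDerivAt_noiseDensity hx.1 hd).deriv]
  ring

end MemLStar

end NoiseDensity

section WienerIntegral

variable {w : ℝ≥0 → ℝ} {g ψ : ℝ → ℝ} {R c : ℝ}

lemma intervalIntegrable_mul_path (hw : Continuous w) (hg : IntervalIntegrable g volume 0 R) :
    IntervalIntegrable (fun x => g x * w x.toNNReal) volume 0 R :=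
  hg.mul_continuousOn (hw.comp continuous_real_toNNReal).continuousOn

lemma integral_mul_eq_sub_integral_deriv_mul_primitive {h : ℝ → ℝ}
    (hh : IntervalIntegrable h volume 0 R) (hψ : ContDiff ℝ 1 ψ) :
    ∫ x in (0 : ℝ)..R, ψ x * h x =
      ψ R * (∫ x in (0 : ℝ)..R, h x) -
        ∫ x in (0 : ℝ)..R, deriv ψ x * ∫ y in (0 : ℝ)..x, h y := by
  have primitive_ac := hh.absolutelyContinuousOnInterval_intervalIntegral (c := 0) left_mem_uIcc
  have parts := (hψ.contDiffOn.absolutelyContinuousOnInterval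
    (a := 0) (b := R)).integral_mul_deriv_eq_deriv_mul primitive_ac
  rw [intervalIntegral.integral_same, mul_zero, sub_zero] at parts
  rw [← parts]
  refine intervalIntegral.integral_congr_ae ?_
  filter_upwards [hh.ae_hasDerivAt_integral] with x hx hxR
  rw [(hx (uIoc_subset_uIcc hxR) 0 left_mem_uIcc).deriv]

lemma wienerIntegralUpTo_mul (hw : Continuous w) (hψ : ContDiff ℝ 1 ψ)
    (hd : ∀ᵐ x ∂volume.restrict (uIoc 0 R), DifferentiableAt ℝ g x)
    (hg : IntervalIntegrable g volume 0 R) (hg' : IntervalIntegrable (deriv g) volume 0 R) :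
    wienerIntegralUpTo w (fun x => g x * ψ x) R =
      ψ R * wienerIntegralUpTo w g R -
        ∫ x in (0 : ℝ)..R, deriv ψ x * wienerIntegralUpTo w g x := by
  have hψ' : ContinuousOn (deriv ψ) (uIcc 0 R) := (hψ.continuous_deriv le_rfl).continuousOn
  have hg'w := intervalIntegrable_mul_path hw hg'
  have hgw := (intervalIntegrable_mul_path hw hg).continuousOn_mul hψ'
  have hψG := ((hg'w.absolutelyContinuousOnInterval_intervalIntegral
    (c := 0) left_mem_uIcc).continuousOn.intervalIntegrable (μ := volume)).continuousOn_mul hψ'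
  have product_rule : ∫ x in (0 : ℝ)..R, deriv (fun y => g y * ψ y) x * w x.toNNReal =
      (∫ x in (0 : ℝ)..R, ψ x * (deriv g x * w x.toNNReal)) +
        ∫ x in (0 : ℝ)..R, deriv ψ x * (g x * w x.toNNReal) := by
    rw [← intervalIntegral.integral_add (hg'w.continuousOn_mul hψ.continuous.continuousOn) hgw]
    refine intervalIntegral.integral_congr_ae_restrict (hd.mono fun x hx => ?_)
    simp only [deriv_fun_mul hx (hψ.differentiable one_ne_zero x)]
    ring
  simp only [wienerIntegralUpTo, mul_sub]
  rw [product_rule, integral_mul_eq_sub_integral_deriv_mul_primitive hg'w hψ,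
    intervalIntegral.integral_sub hgw hψG]
  ring

lemma continuousOn_wienerIntegralUpTo (hw : Continuous w) (hg : ContinuousOn g (Ioi 0))
    (hg' : ∀ M, 0 ≤ M → IntervalIntegrable (deriv g) volume 0 M) :
    ContinuousOn (wienerIntegralUpTo w g) (Ioi 0) := by
  refine (hg.mul (hw.comp continuous_real_toNNReal).continuousOn).sub fun x (hx : 0 < x) => ?_
  have primitive_cont := (intervalIntegrable_mul_path hw
    (hg' (x + 1) (by positivity))).absolutelyContinuousOnInterval_intervalIntegral
    (c := 0) left_mem_uIcc |>.continuousOn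
  rw [uIcc_of_le (by positivity)] at primitive_cont
  exact (primitive_cont.continuousAt (Icc_mem_nhds hx (lt_add_one x))).continuousWithinAt

lemma tendsto_integral_mul_comp_mul_atTop {φ I : ℝ → ℝ} {a b : ℝ} (ha : 0 < a) (hb : 0 ≤ b)
    (hφ : IntervalIntegrable φ volume 0 b) (hφ0 : ∀ u ∈ Ioo 0 a, φ u = 0)
    (hI : ContinuousOn I (Ioi 0)) (hlim : Tendsto I atTop (𝓝 c)) :
    Tendsto (fun R => ∫ u in (0 : ℝ)..b, φ u * I (R * u)) atTop
      (𝓝 ((∫ u in (0 : ℝ)..b, φ u) * c)) := by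
  rw [← intervalIntegral.integral_mul_const]
  obtain ⟨N, hN⟩ := eventually_atTop.1 ((hlim.norm).eventually_le_const (lt_add_one ‖c‖))
  refine intervalIntegral.tendsto_integral_filter_of_dominated_convergence
    (fun u => ‖φ u‖ * (‖c‖ + 1)) ?_ ?_ (hφ.norm.mul_const _) (ae_of_all _ fun u hu => ?_)
  · filter_upwards [eventually_gt_atTop 0] with R hR
    rw [uIoc_of_le hb]
    refine ((intervalIntegrable_iff_integrableOn_Ioc_of_le hb).1 hφ).aestronglyMeasurable.mul
      (ContinuousOn.aestronglyMeasurable ?_ measurableSet_Ioc)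
    exact hI.comp (by fun_prop) fun u hu => mul_pos hR hu.1
  · filter_upwards [eventually_ge_atTop (N / a), eventually_gt_atTop 0] with R hR hR0
    refine ae_of_all _ fun u hu0 => ?_
    rw [uIoc_of_le hb] at hu0
    rcases lt_or_ge u a with hu | hu
    · simp [hφ0 u ⟨hu0.1, hu⟩]
    · rw [norm_mul]
      gcongr
      exact hN _ (((div_le_iff₀ ha).1 hR).trans (by gcongr))
  · rw [uIoc_of_le hb] at hu
    exact (hlim.comp (tendsto_id.atTop_mul_const hu.1)).const_mul (φ u)

lemma HasWienerIntegral.tendsto_mul_comp_div {a b : ℝ} (hc : HasWienerIntegral w g c)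
    (hw : Continuous w) (hd : ∀ᵐ x ∂volume.restrict (Ioi 0), DifferentiableAt ℝ g x)
    (hg : ∀ M, 0 ≤ M → IntervalIntegrable g volume 0 M)
    (hg' : ∀ M, 0 ≤ M → IntervalIntegrable (deriv g) volume 0 M) (hgc : ContinuousOn g (Ioi 0))
    (hψ : ContDiff ℝ 1 ψ) (ha : 0 < a) (hψ' : ∀ u ∈ Ioo 0 a, deriv ψ u = 0) (hb : 0 < b) :
    Tendsto (fun R => wienerIntegralUpTo w (fun x => g x * ψ (x / R)) (R * b)) atTop
      (𝓝 (ψ 0 * c)) := by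
  have hψ'_int : IntervalIntegrable (deriv ψ) volume 0 b :=
    (hψ.continuous_deriv le_rfl).intervalIntegrable _ _
  have hlim := ((hc.comp (tendsto_id.atTop_mul_const hb)).const_mul (ψ b)).sub <|
    tendsto_integral_mul_comp_mul_atTop ha hb.le hψ'_int hψ'
      (continuousOn_wienerIntegralUpTo hw hgc hg') hc
  rw [intervalIntegral.integral_deriv_eq_sub (fun x _ => hψ.differentiable one_ne_zero x)
    hψ'_int, ← sub_mul, sub_sub_cancel] at hlim
  refine hlim.congr' ?_
  filter_upwards [eventually_gt_atTop 0] with R hR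
  have hRb : 0 ≤ R * b := by positivity
  have hψR : ContDiff ℝ 1 fun x => ψ (x / R) := hψ.comp (contDiff_id.div_const R)
  have deriv_scaled (x : ℝ) : deriv (fun y => ψ (y / R)) x = R⁻¹ * deriv ψ (x / R) := by
    simpa [div_eq_inv_mul] using deriv_comp_mul_left R⁻¹ ψ x
  have change_variables : ∫ x in (0 : ℝ)..R * b,
        deriv (fun y => ψ (y / R)) x * wienerIntegralUpTo w g x =
      ∫ u in (0 : ℝ)..b, deriv ψ u * wienerIntegralUpTo w g (R * u) := by
    rw [← mul_zero R, ← intervalIntegral.mul_integral_comp_mul_left,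
      ← intervalIntegral.integral_const_mul]
    simp only [deriv_scaled, mul_zero, mul_div_cancel_left₀ _ hR.ne', ← mul_assoc,
      mul_inv_cancel₀ hR.ne', one_mul]
  rw [wienerIntegralUpTo_mul hw hψR
    (by rw [uIoc_of_le hRb]; exact ae_restrict_of_ae_restrict_of_subset Ioc_subset_Ioi_self hd)
    (hg _ hRb) (hg' _ hRb), change_variables]
  simp [mul_div_cancel_left₀ _ hR.ne']

end WienerIntegral

/-- A smooth function equal to `1` on `[-1, 1]` and to `0` outside `(-2, 2)`, used to replace
elements of `L*` by functions of bounded support. -/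
noncomputable def cutoff : ℝ → ℝ :=
  (⟨1, 2, one_pos, one_lt_two⟩ : ContDiffBump (0 : ℝ))

section Cutoff

lemma contDiff_cutoff : ContDiff ℝ 1 cutoff :=
  ContDiffBump.contDiff _

lemma cutoff_nonneg (x : ℝ) : 0 ≤ cutoff x :=
  ContDiffBump.nonneg _

lemma cutoff_le_one (x : ℝ) : cutoff x ≤ 1 :=
  ContDiffBump.le_one _

lemma cutoff_eventuallyEq_one {x : ℝ} (hx : |x| < 1) : cutoff =ᶠ[𝓝 x] 1 :=
  ContDiffBump.eventuallyEq_one_of_mem_ball _ (by simpa using hx)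

lemma cutoff_eq_zero {x : ℝ} (hx : 2 ≤ |x|) : cutoff x = 0 :=
  ContDiffBump.zero_of_le_dist _ (by simpa using hx)

lemma hasCompactSupport_cutoff : HasCompactSupport cutoff :=
  ContDiffBump.hasCompactSupport (⟨1, 2, one_pos, one_lt_two⟩ : ContDiffBump (0 : ℝ))

lemma exists_abs_deriv_cutoff_le : ∃ C, ∀ x, |deriv cutoff x| ≤ C :=
  hasCompactSupport_cutoff.deriv.exists_bound_of_continuous
    (contDiff_cutoff.continuous_deriv le_rfl)

lemma tendsto_cutoff_div_atTop (x : ℝ) : Tendsto (fun R => cutoff (x / R)) atTop (𝓝 1) := by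
  have h := (contDiff_cutoff.continuous.tendsto 0).comp (tendsto_id.const_div_atTop x)
  rwa [(cutoff_eventuallyEq_one (by simp)).eq_of_nhds] at h

end Cutoff

/-- The function `f` cut off smoothly between `R` and `2R`. -/
noncomputable def truncate (R : ℝ) (f : ℝ → ℝ) (x : ℝ) : ℝ :=
  f x * cutoff (x / R)

lemma truncate_eq_zero {R x : ℝ} (hR : 0 < R) (hx : R * 2 ≤ x) (f : ℝ → ℝ) :
    truncate R f x = 0 := by
  have : 2 ≤ |x / R| := ((le_div_iff₀' hR).2 hx).trans (le_abs_self _)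
  rw [truncate, cutoff_eq_zero this, mul_zero]

lemma noiseDensity_truncate (k : ℕ) (R : ℝ) (f : ℝ → ℝ) :
    noiseDensity k (truncate R f) = fun x => noiseDensity k f x * cutoff (x / R) ^ 2 := by
  ext x
  simp only [noiseDensity, truncate]
  ring

lemma deriv_truncate {f : ℝ → ℝ} {x : ℝ} (hx : DifferentiableAt ℝ f x) (R : ℝ) :
    deriv (truncate R f) x =
      deriv f x * cutoff (x / R) + f x * (R⁻¹ * deriv cutoff (x / R)) := by
  have deriv_scaled : deriv (fun y => cutoff (y / R)) x = R⁻¹ * deriv cutoff (x / R) := by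
    simpa [div_eq_inv_mul] using deriv_comp_mul_left R⁻¹ cutoff x
  have hχ : DifferentiableAt ℝ (fun y => cutoff (y / R)) x :=
    (contDiff_cutoff.differentiable one_ne_zero _).comp x (differentiableAt_id.div_const R)
  rw [← deriv_scaled, ← deriv_fun_mul hx hχ]
  rfl

lemma tendsto_deriv_truncate {f : ℝ → ℝ} {x : ℝ} (hx : DifferentiableAt ℝ f x) :
    Tendsto (fun R => deriv (truncate R f) x) atTop (𝓝 (deriv f x)) := by
  have deriv_cutoff_lim : Tendsto (fun R => R⁻¹ * deriv cutoff (x / R)) atTop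
      (𝓝 (0 * deriv cutoff 0)) :=
    tendsto_inv_atTop_zero.mul
      (((contDiff_cutoff.continuous_deriv le_rfl).tendsto 0).comp (tendsto_id.const_div_atTop x))
  simpa [deriv_truncate hx] using
    ((tendsto_cutoff_div_atTop x).const_mul (deriv f x)).add (deriv_cutoff_lim.const_mul (f x))

lemma integrableOn_mul_sq_truncate {f ρ : ℝ → ℝ} {s : Set ℝ}
    (h : IntegrableOn (fun x => ρ x * f x ^ 2) s) (R : ℝ) :
    IntegrableOn (fun x => ρ x * truncate R f x ^ 2) s := by
  have hχ : Continuous fun x => cutoff (x / R) ^ 2 :=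
    (contDiff_cutoff.continuous.comp (continuous_id.div_const R)).pow 2
  simp only [truncate, mul_pow, ← mul_assoc]
  refine h.mul_bdd (c := 1) hχ.aestronglyMeasurable (ae_of_all _ fun x => ?_)
  rw [Real.norm_of_nonneg (sq_nonneg _)]
  exact pow_le_one₀ (cutoff_nonneg _) (cutoff_le_one _)

lemma tendsto_integral_mul_sq_truncate {f ρ : ℝ → ℝ} {s : Set ℝ}
    (h : IntegrableOn (fun x => ρ x * f x ^ 2) s) :
    Tendsto (fun R => ∫ x in s, ρ x * truncate R f x ^ 2) atTop
      (𝓝 (∫ x in s, ρ x * f x ^ 2)) := by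
  refine tendsto_integral_filter_of_dominated_convergence _
    (.of_forall fun R => (integrableOn_mul_sq_truncate h R).aestronglyMeasurable)
    (.of_forall fun R => ae_of_all _ fun x => ?_) h.norm (ae_of_all _ fun x => ?_)
  · rw [truncate, mul_pow, ← mul_assoc, norm_mul, Real.norm_of_nonneg (sq_nonneg (cutoff _))]
    exact mul_le_of_le_one_right (norm_nonneg _)
      (pow_le_one₀ (cutoff_nonneg _) (cutoff_le_one _))
  · simpa [truncate] using (((tendsto_cutoff_div_atTop x).const_mul (f x)).pow 2).const_mul (ρ x)

namespace MemLStar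

variable {k : ℕ} {f : ℝ → ℝ} {R C : ℝ}

lemma ae_deriv_truncate_sq_le (hf : MemLStar k f) (hR : 1 ≤ R)
    (hC : ∀ x, |deriv cutoff x| ≤ C) :
    ∀ᵐ x ∂volume.restrict (Ioi 0), ‖deriv (truncate R f) x ^ 2‖ ≤
      2 * (deriv f x ^ 2 + C ^ 2 * f x ^ 2) := by
  filter_upwards [hf.ae_differentiableAt] with x hx
  have cutoff_sq_le : cutoff (x / R) ^ 2 ≤ 1 := pow_le_one₀ (cutoff_nonneg _) (cutoff_le_one _)
  have deriv_sq_le : (R⁻¹ * deriv cutoff (x / R)) ^ 2 ≤ C ^ 2 := by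
    rw [← sq_abs, abs_mul, abs_of_nonneg (inv_nonneg.2 (zero_le_one.trans hR))]
    gcongr
    exact (mul_le_of_le_one_left (abs_nonneg _) (inv_le_one_of_one_le₀ hR)).trans (hC _)
  rw [Real.norm_of_nonneg (sq_nonneg _), deriv_truncate hx]
  calc (deriv f x * cutoff (x / R) + f x * (R⁻¹ * deriv cutoff (x / R))) ^ 2
      ≤ 2 * ((deriv f x * cutoff (x / R)) ^ 2 + (f x * (R⁻¹ * deriv cutoff (x / R))) ^ 2) :=
        add_sq_le
    _ = 2 * (deriv f x ^ 2 * cutoff (x / R) ^ 2 +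
          (R⁻¹ * deriv cutoff (x / R)) ^ 2 * f x ^ 2) := by ring
    _ ≤ 2 * (deriv f x ^ 2 + C ^ 2 * f x ^ 2) := by
        gcongr
        exact mul_le_of_le_one_right (sq_nonneg _) cutoff_sq_le

lemma integrableOn_deriv_truncate_sq (hf : MemLStar k f)
    (hf2 : IntegrableOn (fun x => f x ^ 2) (Ioi 0)) (hR : 1 ≤ R) :
    IntegrableOn (fun x => deriv (truncate R f) x ^ 2) (Ioi 0) := by
  obtain ⟨C, hC⟩ := exists_abs_deriv_cutoff_le
  exact ((hf.integrableOn_deriv_sq.add (hf2.const_mul (C ^ 2))).const_mul 2).mono'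
    ((measurable_deriv _).pow_const 2).aestronglyMeasurable (hf.ae_deriv_truncate_sq_le hR hC)

protected lemma truncate (hf : MemLStar k f)
    (hf2 : IntegrableOn (fun x => f x ^ 2) (Ioi 0)) (hR : 1 ≤ R) :
    MemLStar k (truncate R f) where
  absolutelyContinuous M hM := (hf.absolutelyContinuous M hM).fun_mul
    (contDiff_cutoff.comp (contDiff_id.div_const R)).contDiffOn.absolutelyContinuousOnInterval
  map_zero := by simp [truncate, hf.map_zero]
  integrableOn := (hf.integrableOn_deriv_truncate_sq hf2 hR).add
    (integrableOn_mul_sq_truncate hf.integrableOn_potential R)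

lemma tendsto_integral_deriv_truncate_sq (hf : MemLStar k f)
    (hf2 : IntegrableOn (fun x => f x ^ 2) (Ioi 0)) :
    Tendsto (fun R => ∫ x in Ioi (0 : ℝ), deriv (truncate R f) x ^ 2) atTop
      (𝓝 (∫ x in Ioi (0 : ℝ), deriv f x ^ 2)) := by
  obtain ⟨C, hC⟩ := exists_abs_deriv_cutoff_le
  refine tendsto_integral_filter_of_dominated_convergence
    (fun x => 2 * (deriv f x ^ 2 + C ^ 2 * f x ^ 2))
    (.of_forall fun R => ((measurable_deriv _).pow_const 2).aestronglyMeasurable) ?_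
    ((hf.integrableOn_deriv_sq.add (hf2.const_mul (C ^ 2))).const_mul 2)
    (hf.ae_differentiableAt.mono fun x hx => (tendsto_deriv_truncate hx).pow 2)
  filter_upwards [eventually_ge_atTop 1] with R hR
  exact hf.ae_deriv_truncate_sq_le hR hC

lemma tendsto_energy_truncate (hf : MemLStar k f)
    (hf2 : IntegrableOn (fun x => f x ^ 2) (Ioi 0)) :
    Tendsto (fun R => energy k (truncate R f)) atTop (𝓝 (energy k f)) := by
  rw [hf.energy_eq]
  refine ((hf.tendsto_integral_deriv_truncate_sq hf2).add
    (tendsto_integral_mul_sq_truncate hf.integrableOn_potential)).congr' ?_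
  filter_upwards [eventually_ge_atTop 1] with R hR
  exact (hf.truncate hf2 hR).energy_eq.symm

end MemLStar

section BoundedSupport

lemma hasWienerIntegral_of_forall_ge_eq_zero {w : ℝ≥0 → ℝ} {g : ℝ → ℝ} {M : ℝ} (hM : 0 ≤ M)
    (hg : ∀ x, M ≤ x → g x = 0) : HasWienerIntegral w g (wienerIntegralUpTo w g M) := by
  have deriv_eq_zero (x : ℝ) (hx : M < x) : deriv g x = 0 := by
    have : g =ᶠ[𝓝 x] 0 := (eventually_ge_nhds hx).mono hg
    simpa using this.deriv_eq
  refine tendsto_const_nhds.congr' ?_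
  filter_upwards [eventually_ge_atTop M] with R hR
  simp only [wienerIntegralUpTo, hg R hR, hg M le_rfl, intervalIntegral.integral_of_le hM,
    intervalIntegral.integral_of_le (hM.trans hR)]
  rw [setIntegral_eq_of_subset_of_forall_sdiff_eq_zero measurableSet_Ioc (Ioc_subset_Ioc_right hR)]
  · rw [zero_mul, zero_mul]
  · rintro x ⟨⟨hx0, _⟩, hxM⟩
    rw [deriv_eq_zero x (not_le.1 fun h => hxM ⟨hx0, h⟩), zero_mul]

lemma wienerIntegralUpTo_const_mul (w : ℝ≥0 → ℝ) (r : ℝ) (g : ℝ → ℝ) (R : ℝ) :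
    wienerIntegralUpTo w (fun x => r * g x) R = r * wienerIntegralUpTo w g R := by
  simp only [wienerIntegralUpTo, deriv_const_mul_field, mul_assoc,
    intervalIntegral.integral_const_mul, mul_sub]

lemma noiseDensity_const_mul (k : ℕ) (r : ℝ) (f : ℝ → ℝ) :
    noiseDensity k (fun x => r * f x) = fun x => r ^ 2 * noiseDensity k f x := by
  ext x
  simp only [noiseDensity, mul_pow, mul_assoc]

lemma energy_const_mul (k : ℕ) (r : ℝ) (f : ℝ → ℝ) :
    energy k (fun x => r * f x) = r ^ 2 * energy k f := by
  simp only [energy, deriv_const_mul_field, mul_pow, ← integral_const_mul]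
  congr 1 with x
  ring

lemma MemLStar.const_mul {k : ℕ} {f : ℝ → ℝ} (hf : MemLStar k f) (r : ℝ) :
    MemLStar k fun x => r * f x where
  absolutelyContinuous R hR := (hf.absolutelyContinuous R hR).const_mul r
  map_zero := by rw [hf.map_zero, mul_zero]
  integrableOn := by
    refine (hf.integrableOn.const_mul (r ^ 2)).congr (ae_of_all _ fun x => ?_)
    simp only [deriv_const_mul_field]
    ring

/-- The supremum defining `higherTW`, taken only over the functions of bounded support. Their noise
integral is an integral over a bounded interval, so that it exists along every path and depends
continuously on the path. -/
noncomputable def boundedSupportTW (k : ℕ) (β : ℝ) (w : ℝ≥0 → ℝ) : EReal :=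
  ⨆ (M : ℝ≥0) (f : ℝ → ℝ) (_ : MemLStar k f) (_ : ∫ x in Ioi (0 : ℝ), f x ^ 2 = 1)
    (_ : ∀ x : ℝ, M ≤ x → f x = 0),
    ((2 / √β * wienerIntegralUpTo w (noiseDensity k f) M - energy k f : ℝ) : EReal)

variable {k : ℕ} {β c : ℝ} {w : ℝ≥0 → ℝ} {f : ℝ → ℝ}

lemma le_higherTW (hf : MemLStar k f) (hf1 : ∫ x in Ioi (0 : ℝ), f x ^ 2 = 1)
    (hc : HasWienerIntegral w (noiseDensity k f) c) :
    ((2 / √β * c - energy k f : ℝ) : EReal) ≤ higherTW k β w :=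
  le_iSup₂_of_le f hf <| le_iSup₂_of_le hf1 c <| le_iSup_of_le hc le_rfl

lemma higherTW_le {a : EReal} (h : ∀ f c, MemLStar k f → ∫ x in Ioi (0 : ℝ), f x ^ 2 = 1 →
      HasWienerIntegral w (noiseDensity k f) c →
      ((2 / √β * c - energy k f : ℝ) : EReal) ≤ a) :
    higherTW k β w ≤ a :=
  iSup₂_le fun f hf => iSup₂_le fun hf1 c => iSup_le fun hc => h f c hf hf1 hc

lemma boundedSupportTW_le_higherTW (k : ℕ) (β : ℝ) (w : ℝ≥0 → ℝ) :
    boundedSupportTW k β w ≤ higherTW k β w :=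
  iSup₂_le fun M f => iSup₂_le fun hf hf1 => iSup_le fun hfM =>
    le_higherTW hf hf1 <| hasWienerIntegral_of_forall_ge_eq_zero M.coe_nonneg fun x hx => by
      rw [noiseDensity, hfM x hx, zero_pow two_ne_zero, zero_mul]

lemma div_integral_sq_le_boundedSupportTW {M : ℝ≥0} (hf : MemLStar k f)
    (hf0 : 0 < ∫ x in Ioi (0 : ℝ), f x ^ 2) (hfM : ∀ x : ℝ, M ≤ x → f x = 0) :
    (((2 / √β * wienerIntegralUpTo w (noiseDensity k f) M - energy k f) /
      ∫ x in Ioi (0 : ℝ), f x ^ 2 : ℝ) : EReal) ≤ boundedSupportTW k β w := by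
  set N := ∫ x in Ioi (0 : ℝ), f x ^ 2 with hN
  have scale_sq : (√N)⁻¹ ^ 2 = N⁻¹ := by rw [inv_pow, Real.sq_sqrt hf0.le]
  have normalized : ∫ x in Ioi (0 : ℝ), ((√N)⁻¹ * f x) ^ 2 = 1 := by
    simp only [mul_pow, scale_sq, integral_const_mul, ← hN, inv_mul_cancel₀ hf0.ne']
  refine le_iSup₂_of_le M (fun x => (√N)⁻¹ * f x) <| le_iSup₂_of_le (hf.const_mul _) normalized <|
    le_iSup_of_le (fun x hx => mul_eq_zero_of_right _ (hfM x hx))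
      (EReal.coe_le_coe_iff.2 (le_of_eq ?_))
  rw [noiseDensity_const_mul, wienerIntegralUpTo_const_mul, energy_const_mul, scale_sq]
  ring

lemma MemLStar.tendsto_wienerIntegralUpTo_truncate (hf : MemLStar k f) (hw : Continuous w)
    (hc : HasWienerIntegral w (noiseDensity k f) c) :
    Tendsto (fun R => wienerIntegralUpTo w (noiseDensity k (truncate R f)) (R * 2)) atTop
      (𝓝 c) := by
  have noiseDensity_diff :
      ∀ᵐ x ∂volume.restrict (Ioi 0), DifferentiableAt ℝ (noiseDensity k f) x := by
    filter_upwards [ae_restrict_mem measurableSet_Ioi, hf.ae_differentiableAt] with x hx hd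
    exact (hasDerivAt_noiseDensity hx hd).differentiableAt
  have cutoff_sq_flat (x : ℝ) (hx : x ∈ Ioo 0 1) : deriv (fun y => cutoff y ^ 2) x = 0 := by
    have : (fun y => cutoff y ^ 2) =ᶠ[𝓝 x] fun _ => 1 :=
      (cutoff_eventuallyEq_one (by rw [abs_of_pos hx.1]; exact hx.2)).mono fun y hy => by simp [hy]
    rw [this.deriv_eq, deriv_const]
  have hlim := hc.tendsto_mul_comp_div hw noiseDensity_diff
    (fun M => hf.intervalIntegrable_noiseDensity)
    (fun M => hf.intervalIntegrable_deriv_noiseDensity) hf.continuousOn_noiseDensity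
    (contDiff_cutoff.pow 2) one_pos cutoff_sq_flat two_pos
  simpa [noiseDensity_truncate, (cutoff_eventuallyEq_one (x := 0) (by simp)).eq_of_nhds] using hlim

theorem higherTW_eq_boundedSupportTW (k : ℕ) (β : ℝ) (hw : Continuous w) :
    higherTW k β w = boundedSupportTW k β w := by
  refine le_antisymm (higherTW_le fun f c hf hf1 hc => ?_) (boundedSupportTW_le_higherTW k β w)
  have hf2 : IntegrableOn (fun x => f x ^ 2) (Ioi 0) :=
    Integrable.of_integral_ne_zero (by rw [hf1]; exact one_ne_zero)
  have norm_lim : Tendsto (fun R => ∫ x in Ioi (0 : ℝ), truncate R f x ^ 2) atTop (𝓝 1) := by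
    rw [← hf1]
    simpa using tendsto_integral_mul_sq_truncate (ρ := 1) (by simpa using hf2)
  have quotient_lim := (((hf.tendsto_wienerIntegralUpTo_truncate hw hc).const_mul (2 / √β)).sub
    (hf.tendsto_energy_truncate hf2)).div norm_lim one_ne_zero
  rw [div_one] at quotient_lim
  refine le_of_tendsto ((continuous_coe_real_ereal.tendsto _).comp quotient_lim) ?_
  filter_upwards [eventually_ge_atTop 1, norm_lim.eventually_const_lt one_pos] with R hR hN
  have hR0 : 0 < R := one_pos.trans_le hR
  exact div_integral_sq_le_boundedSupportTW (M := ⟨R * 2, by positivity⟩)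
    (hf.truncate hf2 hR) hN fun x hx => truncate_eq_zero hR0 hx f

end BoundedSupport

section Measurability

lemma continuous_wienerIntegralUpTo {g : ℝ → ℝ} {R : ℝ}
    (hg : IntervalIntegrable (deriv g) volume 0 R) :
    Continuous fun w : C(ℝ≥0, ℝ) => wienerIntegralUpTo w g R := by
  refine ((continuous_eval_const _).const_mul _).sub (continuous_iff_continuousAt.2 fun w => ?_)
  have uniform_lim := ContinuousMap.tendsto_iff_forall_isCompact_tendstoUniformlyOn.1
    (tendsto_id (x := 𝓝 w)) _ ((isCompact_uIcc (a := 0) (b := R)).image continuous_real_toNNReal)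
  refine intervalIntegral.tendsto_integral_filter_of_dominated_convergence
    (fun x => ‖deriv g x‖ * (‖w x.toNNReal‖ + 1))
    (.of_forall fun v =>
      (intervalIntegrable_mul_path v.continuous hg).aestronglyMeasurable_restrict_uIoc) ?_
    (intervalIntegrable_mul_path (w.continuous.norm.add continuous_const) hg.norm)
    (ae_of_all _ fun x _ =>
      (((continuous_eval_const x.toNNReal).tendsto w).const_mul (deriv g x)))
  filter_upwards [Metric.tendstoUniformlyOn_iff.1 uniform_lim 1 one_pos] with v hv
  refine ae_of_all _ fun x hx => ?_
  rw [norm_mul]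
  gcongr
  have dist_lt := hv _ (mem_image_of_mem _ (uIoc_subset_uIcc hx))
  rw [id, dist_eq_norm'] at dist_lt
  linarith [norm_sub_norm_le (v x.toNNReal) (w x.toNNReal)]

lemma lowerSemicontinuous_boundedSupportTW (k : ℕ) (β : ℝ) :
    LowerSemicontinuous fun w : C(ℝ≥0, ℝ) => boundedSupportTW k β w :=
  lowerSemicontinuous_iSup fun M => lowerSemicontinuous_iSup fun _ =>
    lowerSemicontinuous_iSup fun hf => lowerSemicontinuous_iSup fun _ =>
    lowerSemicontinuous_iSup fun _ => Continuous.lowerSemicontinuous <|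
      continuous_coe_real_ereal.comp <| ((continuous_wienerIntegralUpTo
        (hf.intervalIntegrable_deriv_noiseDensity M.coe_nonneg)).const_mul _).sub continuous_const

lemma measurable_higherTW (k : ℕ) (β : ℝ) :
    Measurable[borel C(ℝ≥0, ℝ)] fun w : C(ℝ≥0, ℝ) => higherTW k β w := by
  borelize C(ℝ≥0, ℝ)
  simp only [higherTW_eq_boundedSupportTW k β (map_continuous _)]
  exact (lowerSemicontinuous_boundedSupportTW k β).measurable

lemma identDistrib_mul_higherTW {Ω Ω' : Type*} [MeasurableSpace Ω] [MeasurableSpace Ω']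
    {P : Measure Ω} {P' : Measure Ω'} {W : ℝ≥0 → Ω → ℝ} {W' : ℝ≥0 → Ω' → ℝ}
    (hW : IsBrownianReal W P) (hW' : IsBrownianReal W' P') (k : ℕ) (β : ℝ) (r : EReal) :
    IdentDistrib (fun ω => r * higherTW k β (W · ω)) (fun ω => r * higherTW k β (W' · ω)) P P' :=
  identDistrib_brownian_functional (Φ := fun w => r * higherTW k β w) hW hW'
    ((measurable_higherTW k β).const_mul r)

end Measurability

section Dilation

lemma absolutelyContinuousOnInterval_comp_mul_left {X : Type*} [PseudoMetricSpace X] {f : ℝ → X}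
    {m a b : ℝ} (hm : 0 < m) (hf : AbsolutelyContinuousOnInterval f (m * a) (m * b)) :
    AbsolutelyContinuousOnInterval (fun x => f (m * x)) a b := by
  let scale (E : ℕ × (ℕ → ℝ × ℝ)) : ℕ × (ℕ → ℝ × ℝ) :=
    (E.1, fun i => (m * (E.2 i).1, m * (E.2 i).2))
  have length_scale : Tendsto scale AbsolutelyContinuousOnInterval.totalLengthFilter
      AbsolutelyContinuousOnInterval.totalLengthFilter := by
    have hlim : Tendsto (fun E : ℕ × (ℕ → ℝ × ℝ) =>
        m * ∑ i ∈ Finset.range E.1, dist (E.2 i).1 (E.2 i).2)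
        AbsolutelyContinuousOnInterval.totalLengthFilter (𝓝 0) := by
      rw [← mul_zero m]
      exact tendsto_comap.const_mul m
    refine tendsto_comap_iff.2 (hlim.congr fun E => ?_)
    simp only [scale, Function.comp_apply, Real.dist_eq, ← mul_sub, abs_mul, abs_of_pos hm,
      Finset.mul_sum]
  have uIoc_scale (x y : ℝ) : uIoc (m * x) (m * y) = (fun z => m * z) '' uIoc x y := by
    rw [uIoc, uIoc, image_mul_left_Ioc hm, mul_min_of_nonneg _ _ hm.le, mul_max_of_nonneg _ _ hm.le]
  have disjoint_scale : MapsTo scale (AbsolutelyContinuousOnInterval.disjWithin a b)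
      (AbsolutelyContinuousOnInterval.disjWithin (m * a) (m * b)) := by
    intro E ⟨mem_uIcc, disjoint⟩
    rw [AbsolutelyContinuousOnInterval.disjWithin, ← image_const_mul_uIcc]
    refine ⟨fun i hi => ⟨mem_image_of_mem _ (mem_uIcc i hi).1,
      mem_image_of_mem _ (mem_uIcc i hi).2⟩, fun i hi j hj hij => ?_⟩
    simp only [scale, Function.onFun, uIoc_scale]
    exact (disjoint_image_iff (mul_right_injective₀ hm.ne')).2 (disjoint hi hj hij)
  exact hf.comp (length_scale.inf (tendsto_principal_principal.2 disjoint_scale))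

/-- The `L²`-isometric dilation of `f` by the factor `m`. -/
noncomputable def dilate (m : ℝ) (f : ℝ → ℝ) (x : ℝ) : ℝ :=
  √m * f (m * x)

/-- The path with `rescale m w t = m^{-1/2} w (m t)`; the law of Brownian motion is invariant under
this scaling. -/
noncomputable def rescale (m : ℝ≥0) (w : ℝ≥0 → ℝ) (t : ℝ≥0) : ℝ :=
  (√(m : ℝ))⁻¹ * w (m * t)

variable {k : ℕ} {f : ℝ → ℝ} {m : ℝ}

lemma dilate_sq (hm : 0 ≤ m) (f : ℝ → ℝ) (x : ℝ) : dilate m f x ^ 2 = m * f (m * x) ^ 2 := by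
  rw [dilate, mul_pow, Real.sq_sqrt hm]

lemma deriv_dilate_sq (hm : 0 ≤ m) (f : ℝ → ℝ) (x : ℝ) :
    deriv (dilate m f) x ^ 2 = m ^ 2 * (m * deriv f (m * x) ^ 2) := by
  unfold dilate
  rw [deriv_const_mul_field, deriv_comp_mul_left, mul_pow, Real.sq_sqrt hm, smul_eq_mul]
  ring

lemma rpow_mul_dilate_sq (hm : 0 < m) (b : ℝ) (f : ℝ → ℝ) {x : ℝ} (hx : 0 ≤ x) :
    x ^ b * dilate m f x ^ 2 = m ^ (-b) * (m * ((m * x) ^ b * f (m * x) ^ 2)) := by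
  have : m ^ b ≠ 0 := (Real.rpow_pos_of_pos hm b).ne'
  rw [dilate_sq hm.le, Real.mul_rpow hm.le hx, Real.rpow_neg hm.le]
  field_simp

lemma integral_Ioi_mul_comp_mul_left (hm : 0 < m) (g : ℝ → ℝ) :
    ∫ x in Ioi (0 : ℝ), m * g (m * x) = ∫ x in Ioi (0 : ℝ), g x := by
  rw [integral_const_mul, ← smul_eq_mul, integral_comp_mul_left_Ioi' g 0 hm, mul_zero]

lemma integrableOn_Ioi_mul_comp_mul_left (hm : 0 < m) {g : ℝ → ℝ} (hg : IntegrableOn g (Ioi 0)) :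
    IntegrableOn (fun x => m * g (m * x)) (Ioi 0) :=
  ((integrableOn_Ioi_comp_mul_left_iff g 0 hm).2 (by rwa [mul_zero])).const_mul m

lemma integral_dilate_sq (hm : 0 < m) (f : ℝ → ℝ) :
    ∫ x in Ioi (0 : ℝ), dilate m f x ^ 2 = ∫ x in Ioi (0 : ℝ), f x ^ 2 := by
  simp only [dilate_sq hm.le, integral_Ioi_mul_comp_mul_left hm fun x => f x ^ 2]

lemma MemLStar.dilate (hf : MemLStar k f) (hm : 0 < m) : MemLStar k (dilate m f) where
  absolutelyContinuous R hR := (absolutelyContinuousOnInterval_comp_mul_left hm (by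
    simpa using hf.absolutelyContinuous (m * R) (by positivity))).const_mul _
  map_zero := by simp [_root_.dilate, hf.map_zero]
  integrableOn := by
    have kinetic := (integrableOn_Ioi_mul_comp_mul_left hm hf.integrableOn_deriv_sq).const_mul
      (m ^ 2)
    have potential := (integrableOn_Ioi_mul_comp_mul_left hm hf.integrableOn_potential).const_mul
      (m ^ (-(1 / (2 * (k : ℝ) + 1))))
    refine IntegrableOn.congr_fun (kinetic.add potential) (fun x hx => ?_) measurableSet_Ioi
    simp only [Pi.add_apply, deriv_dilate_sq hm.le, rpow_mul_dilate_sq hm _ f (le_of_lt hx)]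

lemma energy_dilate (hf : MemLStar k f) (hm : 0 < m) :
    energy k (dilate m f) = m ^ 2 * (∫ x in Ioi (0 : ℝ), deriv f x ^ 2) +
      m ^ (-(1 / (2 * (k : ℝ) + 1))) *
        ∫ x in Ioi (0 : ℝ), x ^ (1 / (2 * (k : ℝ) + 1)) * f x ^ 2 := by
  rw [(hf.dilate hm).energy_eq, setIntegral_congr_fun measurableSet_Ioi fun x hx =>
    rpow_mul_dilate_sq hm _ f (le_of_lt hx)]
  simp only [deriv_dilate_sq hm.le, integral_const_mul (_ ^ _)]
  rw [integral_Ioi_mul_comp_mul_left hm fun x => deriv f x ^ 2,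
    integral_Ioi_mul_comp_mul_left hm fun x => x ^ (1 / (2 * (k : ℝ) + 1)) * f x ^ 2]

lemma energy_dilate_le {r : ℝ} (hf : MemLStar k f) (hm : 0 < m) (kinetic_le : m ^ 2 ≤ r)
    (potential_le : m ^ (-(1 / (2 * (k : ℝ) + 1))) ≤ r) :
    energy k (dilate m f) ≤ r * energy k f := by
  rw [energy_dilate hf hm, hf.energy_eq, mul_add]
  gcongr
  exact setIntegral_nonneg measurableSet_Ioi fun x (hx : 0 < x) => by positivity

lemma noiseDensity_dilate (hm : 0 < m) (k : ℕ) (f : ℝ → ℝ) {x : ℝ} (hx : 0 ≤ x) :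
    noiseDensity k (dilate m f) x =
      m ^ (1 + (k : ℝ) / (2 * (k : ℝ) + 1)) * noiseDensity k f (m * x) := by
  rw [noiseDensity, mul_comm, rpow_mul_dilate_sq hm _ f hx, noiseDensity, neg_div, neg_neg,
    Real.rpow_add hm, Real.rpow_one]
  ring

lemma deriv_noiseDensity_dilate (hm : 0 < m) (k : ℕ) (f : ℝ → ℝ) {x : ℝ} (hx : 0 < x) :
    deriv (noiseDensity k (dilate m f)) x =
      m ^ (1 + (k : ℝ) / (2 * (k : ℝ) + 1)) * (m * deriv (noiseDensity k f) (m * x)) := by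
  have near : noiseDensity k (dilate m f) =ᶠ[𝓝 x] fun y =>
      m ^ (1 + (k : ℝ) / (2 * (k : ℝ) + 1)) * noiseDensity k f (m * y) :=
    (eventually_ge_nhds hx).mono fun y hy => noiseDensity_dilate hm k f hy
  rw [near.deriv_eq, deriv_const_mul_field, deriv_comp_mul_left, smul_eq_mul]

lemma rescale_toNNReal (m : ℝ≥0) (w : ℝ≥0 → ℝ) (x : ℝ) :
    rescale m w x.toNNReal = (√(m : ℝ))⁻¹ * w (m * x : ℝ).toNNReal := by
  rw [rescale, Real.toNNReal_mul m.coe_nonneg, Real.toNNReal_coe]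

lemma wienerIntegralUpTo_dilate {m : ℝ≥0} (hm : 0 < m) (k : ℕ) (f : ℝ → ℝ) (w : ℝ≥0 → ℝ) {R : ℝ}
    (hR : 0 ≤ R) :
    wienerIntegralUpTo (rescale m w) (noiseDensity k (dilate m f)) R =
      (m : ℝ) ^ (1 / 2 + (k : ℝ) / (2 * (k : ℝ) + 1)) *
        wienerIntegralUpTo w (noiseDensity k f) (m * R) := by
  have hm' : (0 : ℝ) < m := hm
  have scaling_factor : (m : ℝ) ^ (1 / 2 + (k : ℝ) / (2 * (k : ℝ) + 1)) =
      (m : ℝ) ^ (1 + (k : ℝ) / (2 * (k : ℝ) + 1)) * (√(m : ℝ))⁻¹ := by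
    rw [Real.sqrt_eq_rpow, ← Real.rpow_neg hm'.le, ← Real.rpow_add hm']
    ring_nf
  have integrand_eq : ∀ x ∈ Ioc 0 R,
      deriv (noiseDensity k (dilate m f)) x * rescale m w x.toNNReal =
        (m : ℝ) ^ (1 / 2 + (k : ℝ) / (2 * (k : ℝ) + 1)) *
          (m * (deriv (noiseDensity k f) (m * x) * w (m * x : ℝ).toNNReal)) := fun x hx => by
    rw [deriv_noiseDensity_dilate hm' k f hx.1, rescale_toNNReal, scaling_factor]
    ring
  have change_variables :
      ∫ x in (0 : ℝ)..R, deriv (noiseDensity k (dilate m f)) x * rescale m w x.toNNReal =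
        (m : ℝ) ^ (1 / 2 + (k : ℝ) / (2 * (k : ℝ) + 1)) *
          ∫ x in (0 : ℝ)..m * R, deriv (noiseDensity k f) x * w x.toNNReal := by
    rw [intervalIntegral.integral_congr_ae (ae_of_all _ (by rwa [uIoc_of_le hR])),
      intervalIntegral.integral_const_mul, intervalIntegral.integral_const_mul,
      intervalIntegral.mul_integral_comp_mul_left
        (f := fun x => deriv (noiseDensity k f) x * w x.toNNReal), mul_zero]
  rw [wienerIntegralUpTo, wienerIntegralUpTo, change_variables, noiseDensity_dilate hm' k f hR,
    rescale_toNNReal, scaling_factor]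
  ring

lemma HasWienerIntegral.dilate {m : ℝ≥0} (hm : 0 < m) {w : ℝ≥0 → ℝ} {c : ℝ}
    (hc : HasWienerIntegral w (noiseDensity k f) c) :
    HasWienerIntegral (rescale m w) (noiseDensity k (dilate m f))
      ((m : ℝ) ^ (1 / 2 + (k : ℝ) / (2 * (k : ℝ) + 1)) * c) := by
  refine ((hc.comp (tendsto_id.const_mul_atTop (NNReal.coe_pos.2 hm))).const_mul _).congr' ?_
  filter_upwards [eventually_ge_atTop 0] with R hR
  exact (wienerIntegralUpTo_dilate hm k f w hR).symm

lemma mul_higherTW_le_higherTW_rescale {m : ℝ≥0} {r β₁ β₂ : ℝ} (hm : 0 < m)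
    (kinetic_le : (m : ℝ) ^ 2 ≤ r) (potential_le : (m : ℝ) ^ (-(1 / (2 * (k : ℝ) + 1))) ≤ r)
    (noise_eq : (m : ℝ) ^ (1 / 2 + (k : ℝ) / (2 * (k : ℝ) + 1)) / √β₁ = r / √β₂)
    (w : ℝ≥0 → ℝ) : (r : EReal) * higherTW k β₂ w ≤ higherTW k β₁ (rescale m w) := by
  have hm' : (0 : ℝ) < m := hm
  have hr : (0 : EReal) < r := by exact_mod_cast (pow_pos hm' 2).trans_le kinetic_le
  rw [mul_comm, ← EReal.le_div_iff_mul_le hr (EReal.coe_ne_top _)]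
  refine higherTW_le fun f c hf hf1 hc => ?_
  rw [EReal.le_div_iff_mul_le hr (EReal.coe_ne_top _)]
  refine le_trans ?_ (le_higherTW (hf.dilate hm') ((integral_dilate_sq hm' f).trans hf1)
    (hc.dilate hm))
  rw [← EReal.coe_mul, EReal.coe_le_coe_iff]
  calc (2 / √β₂ * c - energy k f) * r
      = 2 * (r / √β₂) * c - r * energy k f := by ring
    _ ≤ 2 * (r / √β₂) * c - energy k (dilate m f) := by
        gcongr
        exact energy_dilate_le hf hm' kinetic_le potential_le
    _ = 2 / √β₁ * (m ^ (1 / 2 + (k : ℝ) / (2 * (k : ℝ) + 1)) * c) - energy k (dilate m f) := by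
        rw [← noise_eq]
        ring

end Dilation

-- The noise condition forces `m = ρ ^ q` with `q = (2s - 1)(2k + 1) / (4k + 1)`; the kinetic bound
-- is then the upper bound on `s`, and the potential bound the lower one.
lemma exists_dilation_factor (k : ℕ) {ρ s : ℝ} (hρ : 1 ≤ ρ) (hs₁ : 1 / (4 * (k : ℝ) + 3) ≤ s)
    (hs₂ : s ≤ (4 * (k : ℝ) + 2) / (4 * (k : ℝ) + 3)) :
    ∃ m : ℝ≥0, 0 < m ∧ (m : ℝ) ^ 2 ≤ ρ ^ s ∧ (m : ℝ) ^ (-(1 / (2 * (k : ℝ) + 1))) ≤ ρ ^ s ∧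
      (m : ℝ) ^ (1 / 2 + (k : ℝ) / (2 * (k : ℝ) + 1)) = ρ ^ s / √ρ := by
  have hρ0 : 0 < ρ := one_pos.trans_le hρ
  rw [div_le_iff₀ (by positivity)] at hs₁
  rw [le_div_iff₀ (by positivity)] at hs₂
  set q : ℝ := (2 * s - 1) * (2 * k + 1) / (4 * k + 1) with hq
  have kinetic_exponent : q * 2 ≤ s := by
    rw [hq, div_mul_eq_mul_div, div_le_iff₀ (by positivity)]
    linarith
  have potential_exponent : q * -(1 / (2 * (k : ℝ) + 1)) ≤ s := by
    rw [show q * -(1 / (2 * (k : ℝ) + 1)) = (1 - 2 * s) / (4 * k + 1) by rw [hq]; field_simp; ring,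
      div_le_iff₀ (by positivity)]
    linarith
  have noise_exponent : q * (1 / 2 + (k : ℝ) / (2 * (k : ℝ) + 1)) = s - 1 / 2 := by
    rw [hq]
    field_simp
    ring
  refine ⟨NNReal.mk (ρ ^ q) (by positivity), Real.rpow_pos_of_pos hρ0 q, ?_, ?_, ?_⟩ <;>
    rw [NNReal.coe_mk]
  · rw [← Real.rpow_mul_natCast hρ0.le]
    exact Real.rpow_le_rpow_of_exponent_le hρ (mod_cast kinetic_exponent)
  · rw [← Real.rpow_mul hρ0.le]
    exact Real.rpow_le_rpow_of_exponent_le hρ potential_exponent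
  · rw [← Real.rpow_mul hρ0.le, noise_exponent, Real.rpow_sub hρ0, Real.sqrt_eq_rpow]

theorem exists_rpow_mul_higherTW_le_rescale (k : ℕ) {β₁ β₂ s : ℝ} (hβ₁ : 0 < β₁) (hβ : β₁ ≤ β₂)
    (hs₁ : 1 / (4 * (k : ℝ) + 3) ≤ s) (hs₂ : s ≤ (4 * (k : ℝ) + 2) / (4 * (k : ℝ) + 3)) :
    ∃ m : ℝ≥0, 0 < m ∧ ∀ w : ℝ≥0 → ℝ, ((β₂ ^ s : ℝ) : EReal) * higherTW k β₂ w ≤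
      ((β₁ ^ s : ℝ) : EReal) * higherTW k β₁ (rescale m w) := by
  have hβ₂ : 0 < β₂ := hβ₁.trans_le hβ
  obtain ⟨m, hm, kinetic_le, potential_le, noise_eq⟩ :=
    exists_dilation_factor k ((one_le_div hβ₁).2 hβ) hs₁ hs₂
  have noise_eq' : (m : ℝ) ^ (1 / 2 + (k : ℝ) / (2 * (k : ℝ) + 1)) / √β₁ =
      (β₂ / β₁) ^ s / √β₂ := by
    rw [noise_eq, Real.sqrt_div hβ₂.le]
    field_simp
  refine ⟨m, hm, fun w => ?_⟩
  rw [← mul_div_cancel₀ (β₂ ^ s) (Real.rpow_pos_of_pos hβ₁ s).ne',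
    ← Real.div_rpow hβ₂.le hβ₁.le, EReal.coe_mul, mul_assoc]
  gcongr
  exact mul_higherTW_le_higherTW_rescale hm kinetic_le potential_le noise_eq' w

theorem theorem3 {Ω₁ Ω₂ : Type*} [MeasurableSpace Ω₁] [MeasurableSpace Ω₂]
    (P₁ : Measure Ω₁) (P₂ : Measure Ω₂) (W₁ : ℝ≥0 → Ω₁ → ℝ) (W₂ : ℝ≥0 → Ω₂ → ℝ)
    (hW₁ : IsBrownianReal W₁ P₁) (hW₂ : IsBrownianReal W₂ P₂)
    (k : ℕ) (β₁ β₂ s : ℝ) (hβ₁ : 0 < β₁) (hβ : β₁ < β₂)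
    (hs₁ : 1 / (4 * (k : ℝ) + 3) ≤ s) (hs₂ : s ≤ (4 * (k : ℝ) + 2) / (4 * (k : ℝ) + 3)) :
    StochDominates
      (fun ω => ((β₁ ^ s : ℝ) : EReal) * higherTW k β₁ (fun x => W₁ x ω)) P₁
      (fun ω => ((β₂ ^ s : ℝ) : EReal) * higherTW k β₂ (fun x => W₂ x ω)) P₂ := by
  obtain ⟨m, hm, hle⟩ := exists_rpow_mul_higherTW_le_rescale k hβ₁ hβ.le hs₁ hs₂
  have same_law := identDistrib_mul_higherTW hW₁ (hW₂.smul hm.ne') k β₁ (β₁ ^ s : ℝ)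
  refine ⟨same_law.aemeasurable_fst,
    (identDistrib_mul_higherTW hW₂ hW₂ k β₂ (β₂ ^ s : ℝ)).aemeasurable_fst, fun t => ?_⟩
  have tail_eq := same_law.measure_mem_eq (measurableSet_Ioi (a := (t : EReal)))
  exact (measure_mono fun ω hω => lt_of_lt_of_le hω (hle (W₂ · ω))).trans_eq tail_eq.symm
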